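/- Let $G=(V,E)$ be a connected, locally finite (simple, undirected) graph that is transitive, i.e. its automorphism group acts transitively on $V$. For $K\subseteq V$ let $\partial_E K$ be the set of edges with one endpoint in $K$ and the other outside $K$, and suppose that $G$ is amenable, i.e. that its Cheeger constant \[ \Phi_E(G)=\inf\left\{\frac{|\partial_E K|}{\sum_{v\in K}\deg(v)} : K\subseteq V \text{ finite and nonempty}\right\} \] is not positive (with $0/0=0$). For $p\in[0,1]$ let $\mathbf P_p$ be the law of Bernoulli-$p$ bond percolation on $G$: the random subgraph $\omega$ obtained by retaining each edge independently with probability $p$ and deleting it otherwise. Let $K_v$ be the cluster (connected component) of $v$ in $\omega$, let $E(K_v)$ be the set of edges of $G$ that have at least one endpoint in $K_v$, and let \[ p_c=\inf\bigl\{p\in[0,1] : \omega \text{ has an infinite cluster } \mathbf P_p\text{-almost surely}\bigr\}, \] the infimum being taken in $[0,1]$ (so that it is $1$ if the set is empty). Define \[ \zeta(p)=-\limsup_{n\to\infty}\frac1n\log \mathbf P_p\bigl(n\le |E(K_v)|<\infty\bigr), \] with values in $[-\infty,\infty]$ and $\log 0=-\infty$. Then, for every vertex $v\in V$ and every $p$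 with $p_c\le p<1$, one has $\zeta(p)=0$. That is, the volumes of finite clusters do not have exponential tails. -/

import Mathlib

noncomputable section

namespace Percolation

open MeasureTheory unitInterval

variable {V : Type*} (G : SimpleGraph V)

/-- `G` is (vertex-)transitive: its automorphism group acts transitively on the vertices. -/
def IsTransitive : Prop := ∀ u v : V, ∃ φ : G ≃g G, φ u = v

/-- The edge boundary `∂_E K`: the edges of `G` with one endpoint in `K` and the other outside. -/
def edgeBoundary (K : Set V) : Set (Sym2 V) :=
  {e | e ∈ G.edgeSet ∧ ∃ u ∈ K, ∃ w ∉ K, e = s(u, w)}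

/-- The Cheeger constant: the infimum of `|∂_E K| / ∑_{v ∈ K} deg v` over the finite *nonempty*
sets of vertices `K`. (In a locally finite graph `∂_E K` is a finite set.) -/
def cheegerConst [G.LocallyFinite] : ℝ :=
  ⨅ K : {K : Finset V // K.Nonempty},
    ((edgeBoundary G (K.1 : Set V)).ncard : ℝ) / ((∑ v ∈ K.1, G.degree v : ℕ) : ℝ)

/-- A locally finite graph is nonamenable if its Cheeger constant is positive. -/
def IsNonamenable [G.LocallyFinite] : Prop := 0 < cheegerConst G

/-- A locally finite graph is amenable if it is not nonamenable. -/
def IsAmenable [G.LocallyFinite] : Prop := ¬ IsNonamenable G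

/-- Percolation configurations `ω ∈ {0,1}^E`; an edge `e` is open (retained) if `ω e = true`. -/
abbrev Config : Type _ := G.edgeSet → Bool

/-- The law `P_p` of Bernoulli-`p` bond percolation on `G`: every edge is retained independently
with probability `p`. -/
def percMeasure (p : I) : Measure (Config G) :=
  Measure.infinitePi fun _ : G.edgeSet ↦ ProbabilityTheory.bernoulliMeasure true false p

variable {G}

/-- The random subgraph of `G` that consists of the open edges of `ω`. -/
def openSubgraph (ω : Config G) : SimpleGraph V :=
  SimpleGraph.fromEdgeSet {e | ∃ h : e ∈ G.edgeSet, ω ⟨e, h⟩ = true}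

/-- The cluster `K_v(ω)`, as a set of vertices. -/
def cluster (ω : Config G) (v : V) : Set V := {u | (openSubgraph ω).Reachable v u}

/-- The set `E(K_v)` of the edges of `G` (open or closed) that have at least one endpoint in the
cluster of `v`. -/
def clusterEdges (ω : Config G) (v : V) : Set (Sym2 V) :=
  {e | e ∈ G.edgeSet ∧ ∃ u ∈ cluster ω v, u ∈ e}

variable (G)

/-- The critical probability. The infimum is taken in `[0,1]`, so it is `1` if there is no `p`
such that there is an infinite cluster almost surely (as on a finite graph). -/
def criticalProb : I :=
  sInf {p : I | ∀ᵐ ω ∂(percMeasure G p), ∃ v : V, (cluster ω v).Infinite}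

/-- The exponential decay rate
`ζ(p) = - limsup_{n → ∞} (1 / n) log P_p (n ≤ |E(K_v)| < ∞)`, computed at the vertex `v`. It takes
values in the extended reals, with `log 0 = -∞`. -/
def zeta (p : I) (v : V) : EReal :=
  - Filter.limsup
      (fun n : ℕ ↦ (((1 / n : ℝ)) : EReal) *
        ENNReal.log (percMeasure G p
          {ω | (n : ℕ∞) ≤ (clusterEdges ω v).encard ∧ (clusterEdges ω v).encard < ⊤}))
      Filter.atTop

end Percolation

end

noncomputable section

namespace Percolation

open MeasureTheory unitInterval Set
open scoped ENNReal NNReal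

/-! ### Cylinder events: change of parameter, independence, monotone coupling. -/

section Cylinder

variable {V : Type*} {G : SimpleGraph V}

/-! If `zeta` is nonzero it is positive, so the finite-cluster tail at n is at most A * s ^ (2 * n)
with s < 1 (`TailBound`). The exponent 2n is a budget: a change of measure or a surgery costs s⁻¹ ^
m on a cluster with m touching edges, and A * s ^ m is still summable. The contradiction has two
cases.

No percolation at p. Then p is critical, by monotonicity. Given the edges touching a finite cluster,
passing from p to a slightly larger q multiplies the probability by at most s⁻¹ per edge. The tails
at q are therefore bounded by tails of a convergent series, so there is no percolation at q, which
exceeds the critical value (`not_tailBound_criticalProb`). Since q ≤ p / s has to allow q > p, this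
needs p > 0; the same comparison, started from parameter 1/2, gives it (`criticalProb_pos`).

Percolation at p (`not_tailBound_of_percolates`). Take a finite K and percolation inside K. If v in
K has an infinite cluster, its cluster C in K touches b ≥ 1 boundary edges of K. Either |C| < 2lb,
which by double counting holds for at most 2l|∂K| vertices v (`card_bad_le`); or b is small compared
with |C|, and closing those b edges turns C into a genuine finite cluster at a cost covered by the
tail bound (`percMeasure_good_le`). Averaging over K bounds the percolation probability by the sum
of A * s ^ m over m ≥ l, plus 2l|∂K|/|K|. Amenability removes the last term for fixed l, and then l
→ ∞. -/

instance (p : I) : IsProbabilityMeasure (percMeasure G p) := by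
  unfold percMeasure; infer_instance

/-- The probability that a given edge has the state `b`. -/
def edgeWeight (p : I) (b : Bool) : ℝ≥0∞ :=
  ProbabilityTheory.bernoulliMeasure true false p {b}

lemma edgeWeight_true (p : I) : edgeWeight p true = ENNReal.ofReal p := by
  simp [edgeWeight, ENNReal.ofReal, toNNReal, Real.toNNReal_of_nonneg p.2.1]
  rfl

lemma edgeWeight_false (p : I) : edgeWeight p false = ENNReal.ofReal (1 - p) := by
  simp [edgeWeight, ENNReal.ofReal, toNNReal,
    Real.toNNReal_of_nonneg (sub_nonneg.2 p.2.2)]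
  rfl

lemma eq_preimage_restrict {A : Set (Config G)} {F : Finset G.edgeSet}
    (hA : DependsOn (· ∈ A) (F : Set G.edgeSet)) :
    A = F.restrict ⁻¹' ((F.restrict (π := fun _ ↦ Bool)) '' A) := by
  refine (subset_preimage_image _ _).antisymm ?_
  rintro ω ⟨η, hη, h⟩
  have : (η ∈ A) = (ω ∈ A) := hA fun e he ↦ congrFun h ⟨e, he⟩
  exact this ▸ hη

lemma measurableSet_of_dependsOn {A : Set (Config G)} {F : Finset G.edgeSet}
    (hA : DependsOn (· ∈ A) (F : Set G.edgeSet)) : MeasurableSet A := by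
  rw [eq_preimage_restrict hA]
  exact Finset.measurable_restrict F (Set.toFinite _).measurableSet

lemma percMeasure_eq_sum {A : Set (Config G)} {F : Finset G.edgeSet}
    (hA : DependsOn (· ∈ A) (F : Set G.edgeSet)) (p : I) :
    percMeasure G p A =
      ∑ s ∈ (Set.toFinite ((F.restrict (π := fun _ ↦ Bool)) '' A)).toFinset,
        ∏ e, edgeWeight p (s e) := by
  conv_lhs => rw [eq_preimage_restrict hA]
  rw [← Measure.map_apply (Finset.measurable_restrict F) (Set.toFinite _).measurableSet,
    percMeasure, Measure.infinitePi_map_restrict]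
  conv_lhs => rw [← (Set.toFinite ((F.restrict (π := fun _ ↦ Bool)) '' A)).coe_toFinset]
  rw [← sum_measure_singleton]
  exact Finset.sum_congr rfl fun s _ ↦ by rw [Measure.pi_singleton]; rfl

/-- Comparison of the probabilities of a cylinder event for two values of the parameter. -/
lemma percMeasure_le_mul {A : Set (Config G)} {F : Finset G.edgeSet}
    (hA : DependsOn (· ∈ A) (F : Set G.edgeSet)) (p q : I) (M : ℝ≥0∞)
    (h : ∀ ω ∈ A, ∏ e ∈ F, edgeWeight q (ω e) ≤ M * ∏ e ∈ F, edgeWeight p (ω e)) :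
    percMeasure G q A ≤ M * percMeasure G p A := by
  rw [percMeasure_eq_sum hA, percMeasure_eq_sum hA, Finset.mul_sum]
  refine Finset.sum_le_sum fun s hs ↦ ?_
  obtain ⟨ω, hω, rfl⟩ := (Set.Finite.mem_toFinset _).1 hs
  have := h ω hω
  rwa [← Finset.prod_coe_sort F fun e ↦ edgeWeight q (ω e),
    ← Finset.prod_coe_sort F fun e ↦ edgeWeight p (ω e)] at this

/-- An event that depends on the edges of `F` is independent of the event that all the edges of a
finite set `B` disjoint from `F` are closed. -/
lemma percMeasure_inter_closed {A : Set (Config G)} {F B : Finset G.edgeSet}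
    (hA : DependsOn (· ∈ A) (F : Set G.edgeSet)) (hd : Disjoint F B) (p : I) :
    percMeasure G p (A ∩ {ω | ∀ e ∈ B, ω e = false}) =
      percMeasure G p A * edgeWeight p false ^ B.card := by
  classical
  have hind := (ProbabilityTheory.iIndepFun_infinitePi (fun _ : G.edgeSet ↦
    (measurable_id : Measurable (id : Bool → Bool)))
    (P := fun _ ↦ ProbabilityTheory.bernoulliMeasure true false p)).indepFun_finset F B hd
    (fun e ↦ measurable_pi_apply e)
  have hB : {ω : Config G | ∀ e ∈ B, ω e = false} = Set.pi B (fun _ ↦ {false}) := by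
    ext; simp
  have hB' : {ω : Config G | ∀ e ∈ B, ω e = false} =
      (B.restrict (π := fun _ ↦ Bool)) ⁻¹' {s | ∀ e, s e = false} := by
    ext; simp
  have hPB : percMeasure G p {ω : Config G | ∀ e ∈ B, ω e = false} =
      edgeWeight p false ^ B.card := by
    rw [hB, percMeasure, Measure.infinitePi_pi _ (by simp)]
    simp [edgeWeight]
  rw [← hPB]
  have := hind.measure_inter_preimage_eq_mul ((F.restrict (π := fun _ ↦ Bool)) '' A)
    {s | ∀ e, s e = false} (Set.toFinite _).measurableSet (Set.toFinite _).measurableSet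
  rw [hB']
  conv_lhs => rw [eq_preimage_restrict hA]
  conv_rhs => rw [eq_preimage_restrict hA]
  exact this

/-- Monotonicity in `p` of the probability of an increasing event. -/
lemma percMeasure_mono {A : Set (Config G)} (hA : MeasurableSet A) (hup : IsUpperSet A)
    {p q : I} (hqp : q ≤ p) : percMeasure G q A ≤ percMeasure G p A := by
  -- Standard coupling: independent uniform labels on the edges, an edge being open at level r when
  -- its label is at most r.
  let f (r : I) : I → Bool := fun u ↦ decide (u ≤ r)
  have hf (r : I) : Measurable (f r) := by
    refine measurable_to_bool ?_
    have : f r ⁻¹' {true} = Iic r := by ext; simp [f]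
    rw [this]; exact measurableSet_Iic
  have hmap (r : I) : (volume : Measure I).map (f r) =
      ProbabilityTheory.bernoulliMeasure true false r := by
    have h1 (b : Bool) : f r ⁻¹' {b} = if b then Iic r else Ioi r := by
      ext; cases b <;> simp [f]
    refine Measure.ext_of_singleton fun b ↦ ?_
    rw [Measure.map_apply (hf r) (by simp), h1]
    cases b
    · exact (by simp : volume (Ioi r) = ENNReal.ofReal (1 - r)).trans (edgeWeight_false r).symm
    · exact (by simp : volume (Iic r) = ENNReal.ofReal r).trans (edgeWeight_true r).symm
  have hP (r : I) : percMeasure G r = (Measure.infinitePi fun _ : G.edgeSet ↦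
      (volume : Measure I)).map (fun u e ↦ f r (u e)) := by
    rw [Measure.infinitePi_map_pi _ (fun _ ↦ hf r), percMeasure]
    simp_rw [hmap]
  have hm (r : I) : Measurable (fun (u : G.edgeSet → I) e ↦ f r (u e)) :=
    measurable_pi_lambda _ fun e ↦ (hf r).comp (measurable_pi_apply e)
  rw [hP q, hP p, Measure.map_apply (hm q) hA, Measure.map_apply (hm p) hA]
  refine measure_mono fun u hu ↦ hup (fun e ↦ ?_) hu
  simp only [f]
  by_cases h : u e ≤ q
  · simp [h, h.trans hqp]
  · simp [h]

end Cylinder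

/-! ### Clusters, their finite-volume approximations, and measurability. -/

section Clusters

variable {V : Type*} {G : SimpleGraph V}

lemma openSubgraph_adj {ω : Config G} {a b : V} :
    (openSubgraph ω).Adj a b ↔ ∃ h : s(a, b) ∈ G.edgeSet, ω ⟨s(a, b), h⟩ = true := by
  simp only [openSubgraph, SimpleGraph.fromEdgeSet_adj, mem_ofPred_eq, and_iff_left_iff_imp]
  rintro ⟨h, -⟩
  exact G.ne_of_adj h

lemma openSubgraph_mono {ω η : Config G} (h : ω ≤ η) : openSubgraph ω ≤ openSubgraph η := by
  intro a b hab
  obtain ⟨he, ho⟩ := openSubgraph_adj.1 hab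
  exact openSubgraph_adj.2 ⟨he, (h ⟨_, he⟩) ho⟩

lemma cluster_mono {ω η : Config G} (h : ω ≤ η) (v : V) : cluster ω v ⊆ cluster η v :=
  fun _ hu ↦ SimpleGraph.Reachable.mono (openSubgraph_mono h) hu

lemma mem_cluster_self (ω : Config G) (v : V) : v ∈ cluster ω v :=
  SimpleGraph.Reachable.refl v

lemma cluster_eq_of_mem {ω : Config G} {u v : V} (h : u ∈ cluster ω v) :
    cluster ω u = cluster ω v := by
  ext w
  exact ⟨fun hw ↦ SimpleGraph.Reachable.trans h hw,
    fun hw ↦ (SimpleGraph.Reachable.symm h).trans hw⟩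

/-- The edges of `G` with at least one endpoint in `C`. -/
def touching (G : SimpleGraph V) (C : Set V) : Set G.edgeSet := {e | ∃ u ∈ C, u ∈ e.1}

lemma touching_mono {C D : Set V} (h : C ⊆ D) : touching G C ⊆ touching G D :=
  fun _ ⟨u, hu, hue⟩ ↦ ⟨u, h hu, hue⟩

lemma encard_clusterEdges (ω : Config G) (v : V) :
    (clusterEdges ω v).encard = (touching G (cluster ω v)).encard := by
  rw [← Subtype.val_injective.encard_image]
  congr 1
  ext e
  simp only [clusterEdges, touching, mem_ofPred_eq, mem_image, Subtype.exists, exists_and_right,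
    exists_eq_right]
  exact ⟨fun ⟨h, h'⟩ ↦ ⟨h, h'⟩, fun ⟨h, h'⟩ ↦ ⟨h, h'⟩⟩

/-- Exploration argument: an open path of ω from v never leaves C, so it uses only edges touching C,
and these are open in η as well. -/
lemma subset_cluster_of_agree {ω η : Config G} {v : V} {C : Set V}
    (hv : v ∈ C) (hC : ∀ a ∈ C, ∀ b, (openSubgraph ω).Adj a b → b ∈ C)
    (h : ∀ e ∈ touching G C, ω e = η e) : cluster ω v ⊆ C ∩ cluster η v := by
  intro u hu
  have hu' : (openSubgraph ω).Reachable v u := hu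
  rw [SimpleGraph.reachable_iff_reflTransGen] at hu'
  induction hu' with
  | refl => exact ⟨hv, mem_cluster_self _ _⟩
  | @tail a b hva hab ih =>
    have ha := ih ((SimpleGraph.reachable_iff_reflTransGen _ _).2 hva)
    refine ⟨hC a ha.1 b hab, SimpleGraph.Reachable.trans ha.2 (SimpleGraph.Adj.reachable ?_)⟩
    obtain ⟨he, ho⟩ := openSubgraph_adj.1 hab
    exact openSubgraph_adj.2 ⟨he, by rw [← h _ ⟨a, ha.1, by simp⟩, ho]⟩

lemma mem_cluster_of_adj {ω : Config G} {v a b : V} (ha : a ∈ cluster ω v)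
    (hab : (openSubgraph ω).Adj a b) : b ∈ cluster ω v :=
  SimpleGraph.Reachable.trans ha hab.reachable

/-- The cluster is determined by the states of the edges that touch it. -/
lemma cluster_eq_of_agree {ω η : Config G} {v : V}
    (h : ∀ e ∈ touching G (cluster ω v), ω e = η e) : cluster η v = cluster ω v := by
  refine Subset.antisymm ?_ ?_
  · refine (subset_cluster_of_agree (ω := η) (η := ω) (mem_cluster_self ω v) ?_
      fun e he ↦ (h e he).symm).trans inter_subset_left
    intro a ha b hab
    obtain ⟨he, ho⟩ := openSubgraph_adj.1 hab
    exact mem_cluster_of_adj ha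
      (openSubgraph_adj.2 ⟨he, by rw [h _ ⟨a, ha, by simp⟩, ho]⟩)
  · exact (subset_cluster_of_agree (mem_cluster_self ω v)
      (fun a ha b hab ↦ mem_cluster_of_adj ha hab) h).trans inter_subset_right

open scoped Classical in
/-- The configuration obtained from `ω` by closing all the edges outside `F`. -/
def trunc (F : Finset G.edgeSet) (ω : Config G) : Config G := fun e ↦ if e ∈ F then ω e else false

lemma trunc_of_mem {F : Finset G.edgeSet} {e : G.edgeSet} (he : e ∈ F) (ω : Config G) :
    trunc F ω e = ω e := if_pos he

lemma trunc_of_notMem {F : Finset G.edgeSet} {e : G.edgeSet} (he : e ∉ F) (ω : Config G) :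
    trunc F ω e = false := if_neg he

lemma trunc_le (F : Finset G.edgeSet) (ω : Config G) : trunc F ω ≤ ω := by
  intro e
  by_cases he : e ∈ F
  · exact (trunc_of_mem he ω).le
  · rw [trunc_of_notMem he]; exact Bool.false_le _

lemma trunc_mono {F F' : Finset G.edgeSet} (h : F ⊆ F') (ω : Config G) :
    trunc F ω ≤ trunc F' ω := by
  intro e
  by_cases he : e ∈ F
  · rw [trunc_of_mem he, trunc_of_mem (h he)]
  · rw [trunc_of_notMem he]; exact Bool.false_le _

lemma dependsOn_trunc {β : Type*} (F : Finset G.edgeSet) (f : Config G → β) :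
    DependsOn (fun ω ↦ f (trunc F ω)) (F : Set G.edgeSet) := by
  intro ω η h
  have : trunc F ω = trunc F η := by
    ext e
    by_cases he : e ∈ F
    · rw [trunc_of_mem he, trunc_of_mem he, h e he]
    · rw [trunc_of_notMem he, trunc_of_notMem he]
  simp only [this]

/-- A vertex of the cluster is reached through finitely many edges. -/
lemma exists_mem_cluster_trunc {ω : Config G} {v u : V} (hu : u ∈ cluster ω v) :
    ∃ F, u ∈ cluster (trunc F ω) v := by
  classical
  have hu' : (openSubgraph ω).Reachable v u := hu
  rw [SimpleGraph.reachable_iff_reflTransGen] at hu'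
  induction hu' with
  | refl => exact ⟨∅, mem_cluster_self _ _⟩
  | @tail a b hva hab ih =>
    obtain ⟨F, hF⟩ := ih ((SimpleGraph.reachable_iff_reflTransGen _ _).2 hva)
    obtain ⟨he, ho⟩ := openSubgraph_adj.1 hab
    refine ⟨insert ⟨s(a, b), he⟩ F, mem_cluster_of_adj
      (cluster_mono (trunc_mono (Finset.subset_insert _ _) ω) v hF)
      (openSubgraph_adj.2 ⟨he, ?_⟩)⟩
    rw [trunc_of_mem (Finset.mem_insert_self _ _), ho]

open scoped Classical in
/-- The edges of `F` that touch the cluster of `v` in the configuration restricted to `F`. -/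
def truncEdges (F : Finset G.edgeSet) (v : V) (ω : Config G) : Finset G.edgeSet :=
  F.filter (· ∈ touching G (cluster (trunc F ω) v))

lemma mem_truncEdges {F : Finset G.edgeSet} {v : V} {ω : Config G} {e : G.edgeSet} :
    e ∈ truncEdges F v ω ↔ e ∈ F ∧ e ∈ touching G (cluster (trunc F ω) v) := by
  simp [truncEdges]

lemma truncEdges_mono {F F' : Finset G.edgeSet} (h : F ⊆ F') (v : V) (ω : Config G) :
    truncEdges F v ω ⊆ truncEdges F' v ω := by
  intro e he
  rw [mem_truncEdges] at he ⊢
  exact ⟨h he.1, touching_mono (cluster_mono (trunc_mono h ω) v) he.2⟩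

lemma truncEdges_subset (F : Finset G.edgeSet) (v : V) (ω : Config G) :
    (truncEdges F v ω : Set G.edgeSet) ⊆ touching G (cluster ω v) := by
  intro e he
  exact touching_mono (cluster_mono (trunc_le F ω) v) (mem_truncEdges.1 he).2

/-- Edges touching the cluster are detected by restricting to a finite set of edges. -/
lemma exists_subset_truncEdges {ω : Config G} {v : V} (S : Finset G.edgeSet)
    (hS : (S : Set G.edgeSet) ⊆ touching G (cluster ω v)) : ∃ F, S ⊆ truncEdges F v ω := by
  classical
  induction S using Finset.induction_on with
  | empty => exact ⟨∅, by simp⟩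
  | insert e S _ ih =>
    simp only [Finset.coe_insert, insert_subset_iff] at hS
    obtain ⟨F, hF⟩ := ih hS.2
    obtain ⟨u, hu, hue⟩ := hS.1
    obtain ⟨F', hF'⟩ := exists_mem_cluster_trunc hu
    refine ⟨insert e (F ∪ F'), Finset.insert_subset (mem_truncEdges.2
      ⟨Finset.mem_insert_self _ _, u, ?_, hue⟩) (hF.trans (truncEdges_mono ?_ v ω))⟩
    · refine cluster_mono (trunc_mono ?_ ω) v hF'
      exact Finset.subset_union_right.trans (Finset.subset_insert _ _)
    · exact Finset.subset_union_left.trans (Finset.subset_insert _ _)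

/-- Reduces the size of the cluster to cylinder events increasing in F; measurability and the
passage to the limit from finite volume both rest on this. -/
lemma natCast_le_encard_iff {ω : Config G} {v : V} {n : ℕ} :
    (n : ℕ∞) ≤ (clusterEdges ω v).encard ↔ ∃ F, n ≤ (truncEdges F v ω).card := by
  rw [encard_clusterEdges]
  constructor
  · intro h
    obtain ⟨t, ht, htn⟩ := exists_subset_encard_eq h
    have hf : t.Finite := finite_of_encard_eq_coe htn
    obtain ⟨F, hF⟩ := exists_subset_truncEdges hf.toFinset (by simpa using ht)
    refine ⟨F, le_trans ?_ (Finset.card_le_card hF)⟩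
    rw [hf.encard_eq_coe_toFinset_card] at htn
    exact_mod_cast htn.ge
  · rintro ⟨F, hF⟩
    refine le_trans ?_ (encard_le_encard (truncEdges_subset F v ω))
    rw [encard_coe_eq_coe_finsetCard]
    exact_mod_cast hF

/-- The event that the finite-volume cluster touches exactly the edges `D` depends on `D`. -/
lemma dependsOn_truncEdges_eq (F D : Finset G.edgeSet) (v : V) :
    DependsOn (· ∈ {ω : Config G | truncEdges F v ω = D}) (D : Set G.edgeSet) := by
  have key : ∀ ω η : Config G, (∀ e ∈ (D : Set G.edgeSet), ω e = η e) →
      truncEdges F v ω = D → truncEdges F v η = D := by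
    rintro ω η h rfl
    have : cluster (trunc F η) v = cluster (trunc F ω) v := by
      refine cluster_eq_of_agree fun e he ↦ ?_
      by_cases heF : e ∈ F
      · rw [trunc_of_mem heF, trunc_of_mem heF]
        exact h e (mem_truncEdges.2 ⟨heF, he⟩)
      -- Touching edges outside F are closed in both truncations, so only those in D matter.
      · rw [trunc_of_notMem heF, trunc_of_notMem heF]
    ext e
    simp [mem_truncEdges, this]
  intro ω η h
  exact propext ⟨key ω η h, key η ω fun e he ↦ (h e he).symm⟩

/-- The event that the cluster of `v` touches at least `n` edges. -/
def sizeGE (G : SimpleGraph V) (v : V) (n : ℕ) : Set (Config G) :=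
  {ω | (n : ℕ∞) ≤ (clusterEdges ω v).encard}

/-- The event that the cluster of `v` touches infinitely many edges. -/
def sizeTop (G : SimpleGraph V) (v : V) : Set (Config G) := {ω | (clusterEdges ω v).encard = ⊤}

lemma sizeGE_eq_iUnion (v : V) (n : ℕ) :
    sizeGE G v n = ⋃ F, {ω | n ≤ (truncEdges F v ω).card} := by
  ext ω
  simp [sizeGE, natCast_le_encard_iff]

lemma sizeTop_eq_iInter (v : V) : sizeTop G v = ⋂ n, sizeGE G v n := by
  ext ω
  simp only [sizeTop, sizeGE, mem_ofPred_eq, mem_iInter]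
  exact ⟨fun h n ↦ h ▸ le_top, fun h ↦ ENat.eq_top_iff_forall_ge.2 h⟩

lemma measurableSet_le_card_truncEdges (F : Finset G.edgeSet) (v : V) (n : ℕ) :
    MeasurableSet {ω : Config G | n ≤ (truncEdges F v ω).card} := by
  classical
  exact measurableSet_of_dependsOn (F := F) (dependsOn_trunc F
    (fun ω ↦ n ≤ (F.filter (· ∈ touching G (cluster ω v))).card))

lemma measurableSet_sizeGE [Countable V] (v : V) (n : ℕ) : MeasurableSet (sizeGE G v n) := by
  have : Countable (Sym2 V) := Sym2.mk_surjective.countable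
  rw [sizeGE_eq_iUnion]
  exact MeasurableSet.iUnion fun F ↦ measurableSet_le_card_truncEdges F v n

lemma measurableSet_sizeTop [Countable V] (v : V) : MeasurableSet (sizeTop G v) := by
  rw [sizeTop_eq_iInter]
  exact MeasurableSet.iInter fun n ↦ measurableSet_sizeGE v n

lemma isUpperSet_sizeTop (v : V) : IsUpperSet (sizeTop G v) := by
  intro ω η h hω
  have h' : (clusterEdges ω v).encard = ⊤ := hω
  refine top_le_iff.1 (h' ▸ ?_)
  rw [encard_clusterEdges, encard_clusterEdges]
  exact encard_le_encard (touching_mono (cluster_mono h v))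

lemma encard_clusterEdges_of_infinite {ω : Config G} {v : V} (h : (cluster ω v).Infinite) :
    (clusterEdges ω v).encard = ⊤ := by
  rw [encard_eq_top_iff]
  refine fun hfin ↦ h ?_
  -- Every vertex other than v is the end of the last edge of an open path, and an edge has only two
  -- endpoints.
  have hsub : cluster ω v ⊆ insert v (⋃ e ∈ clusterEdges ω v, {u | u ∈ e}) := by
    intro u hu
    rcases eq_or_ne u v with rfl | huv
    · exact mem_insert _ _
    · right
      have hr : (openSubgraph ω).Reachable v u := hu
      rw [SimpleGraph.reachable_iff_reflTransGen] at hr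
      rcases Relation.ReflTransGen.cases_tail hr with h' | ⟨a, -, hau⟩
      · exact absurd h' huv
      · obtain ⟨he, -⟩ := openSubgraph_adj.1 hau
        exact mem_biUnion (x := s(a, u)) ⟨he, u, hu, by simp⟩ (by simp)
  refine Finite.subset (Finite.insert _ (hfin.biUnion fun e _ ↦ ?_)) hsub
  induction e with | _ a b =>
  exact (Set.toFinite {a, b}).subset fun x hx ↦ by simpa using hx

end Clusters

/-! ### Comparing cluster-size tails at two parameters. -/

section FiniteVolume

variable {V : Type*} {G : SimpleGraph V}

/-- Split according to the exact touching set D: each piece depends on D alone, so a pointwise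
comparison of the weights over D suffices. -/
lemma percMeasure_card_truncEdges_le {v : V} {p q : I} {m : ℕ} {M : ℝ≥0∞} (F : Finset G.edgeSet)
    (hM : ∀ ω : Config G, (truncEdges F v ω).card = m →
      ∏ e ∈ truncEdges F v ω, edgeWeight q (ω e) ≤
        M * ∏ e ∈ truncEdges F v ω, edgeWeight p (ω e)) :
    percMeasure G q {ω | (truncEdges F v ω).card = m} ≤
      M * percMeasure G p {ω | (truncEdges F v ω).card = m} := by
  classical
  have hU : {ω : Config G | (truncEdges F v ω).card = m} =
      ⋃ D ∈ F.powersetCard m, {ω | truncEdges F v ω = D} := by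
    ext ω
    simp only [mem_ofPred_eq, Finset.mem_powersetCard, mem_iUnion, exists_prop, exists_eq_right']
    exact ⟨fun h ↦ ⟨Finset.filter_subset _ _, h⟩, fun h ↦ h.2⟩
  have hmeas (D : Finset G.edgeSet) : MeasurableSet {ω : Config G | truncEdges F v ω = D} :=
    measurableSet_of_dependsOn (dependsOn_truncEdges_eq F D v)
  have hdisj : (F.powersetCard m : Set (Finset G.edgeSet)).PairwiseDisjoint
      fun D ↦ {ω : Config G | truncEdges F v ω = D} := by
    intro D _ D' _ hDD'
    refine Set.disjoint_left.2 fun ω h h' ↦ hDD' ?_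
    exact (show truncEdges F v ω = D from h).symm.trans h'
  rw [hU, measure_biUnion_finset hdisj fun D _ ↦ hmeas D,
    measure_biUnion_finset hdisj fun D _ ↦ hmeas D, Finset.mul_sum]
  refine Finset.sum_le_sum fun D hD ↦ ?_
  refine percMeasure_le_mul (dependsOn_truncEdges_eq F D v) p q M fun ω hω ↦ ?_
  have hω' : truncEdges F v ω = D := hω
  subst hω'
  exact hM ω (Finset.mem_powersetCard.1 hD).2

lemma exists_open_edge {ω : Config G} {v u x : V} (hu : u ∈ cluster ω v) (huv : u ≠ v)
    (hx : x ∈ cluster ω v) : ∃ o : G.edgeSet, x ∈ o.1 ∧ ω o = true := by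
  obtain ⟨y, hyx, hy⟩ : ∃ y, y ≠ x ∧ x ∈ cluster ω y := by
    by_cases h : x = v
    · exact ⟨u, h ▸ huv, by rw [cluster_eq_of_mem hu]; exact hx⟩
    · exact ⟨v, Ne.symm h, hx⟩
  have hr : (openSubgraph ω).Reachable y x := hy
  rw [SimpleGraph.reachable_iff_reflTransGen] at hr
  rcases Relation.ReflTransGen.cases_tail hr with h' | ⟨a, -, hax⟩
  · exact absurd h'.symm hyx
  · obtain ⟨he, ho⟩ := openSubgraph_adj.1 hax
    exact ⟨⟨s(a, x), he⟩, by simp, ho⟩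

variable [Countable V]

lemma percMeasure_sizeGE_eq_iSup (p : I) (v : V) (n : ℕ) :
    percMeasure G p (sizeGE G v n) =
      ⨆ F, percMeasure G p {ω | n ≤ (truncEdges F v ω).card} := by
  classical
  have : Countable (Sym2 V) := Sym2.mk_surjective.countable
  rw [sizeGE_eq_iUnion, Directed.measure_iUnion]
  exact directed_of_isDirected_le fun F F' h ω hω ↦
    le_trans (show n ≤ _ from hω) (Finset.card_le_card (truncEdges_mono h v ω))

/-- Comparison of the tails of the cluster size for two values of the parameter. -/
lemma percMeasure_sizeGE_le {v : V} {p q : I} {N : ℕ} {g : ℕ → ℝ≥0∞}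
    (hg : ∀ (F : Finset G.edgeSet) (ω : Config G), N ≤ (truncEdges F v ω).card →
      ∏ e ∈ truncEdges F v ω, edgeWeight q (ω e) ≤
        g (truncEdges F v ω).card * ∏ e ∈ truncEdges F v ω, edgeWeight p (ω e))
    {n : ℕ} (hn : N ≤ n) :
    percMeasure G q (sizeGE G v n) ≤
      ∑' k, g (k + n) * percMeasure G p (sizeGE G v (k + n)) := by
  rw [percMeasure_sizeGE_eq_iSup]
  refine iSup_le fun F ↦ ?_
  have hsub : {ω : Config G | n ≤ (truncEdges F v ω).card} ⊆
      ⋃ k, {ω | (truncEdges F v ω).card = k + n} := by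
    intro ω hω
    obtain ⟨k, hk⟩ := Nat.exists_eq_add_of_le' (show n ≤ (truncEdges F v ω).card from hω)
    exact mem_iUnion.2 ⟨k, hk⟩
  refine (measure_mono hsub).trans ((measure_iUnion_le _).trans (ENNReal.tsum_le_tsum fun k ↦ ?_))
  refine (percMeasure_card_truncEdges_le F (p := p) (M := g (k + n)) ?_).trans ?_
  · intro ω h
    exact h ▸ hg F ω (by omega)
  · gcongr
    intro ω hω
    exact natCast_le_encard_iff.2 ⟨F, (show (truncEdges F v ω).card = k + n from hω).ge⟩

/-- An infinite cluster has size at least n for every n, so its probability is below every tail of a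
convergent series. -/
lemma percMeasure_sizeTop_eq_zero {v : V} {p q : I} {N : ℕ} {g : ℕ → ℝ≥0∞}
    (hg : ∀ (F : Finset G.edgeSet) (ω : Config G), N ≤ (truncEdges F v ω).card →
      ∏ e ∈ truncEdges F v ω, edgeWeight q (ω e) ≤
        g (truncEdges F v ω).card * ∏ e ∈ truncEdges F v ω, edgeWeight p (ω e))
    (hs : ∑' m, g m * percMeasure G p (sizeGE G v m) ≠ ∞) :
    percMeasure G q (sizeTop G v) = 0 := by
  have ht := ENNReal.tendsto_sum_nat_add (fun m ↦ g m * percMeasure G p (sizeGE G v m)) hs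
  refine le_antisymm (ge_of_tendsto ht ?_) zero_le
  filter_upwards [Filter.eventually_ge_atTop N] with n hn
  refine le_trans (measure_mono ?_) (percMeasure_sizeGE_le hg hn)
  rw [sizeTop_eq_iInter]
  exact iInter_subset _ n

/-- The probability that the cluster of `v` is finite and touches at least `n` edges is at most
`A * s ^ (2 * n)`. -/
def TailBound (G : SimpleGraph V) (p : I) (v : V) (A s : ℝ≥0∞) : Prop :=
  ∀ n, percMeasure G p (sizeGE G v n \ sizeTop G v) ≤ A * s ^ (2 * n)

/-- If there is no percolation at `p` and the cluster size has an exponential tail, then there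
is no percolation slightly above `p`. -/
lemma percMeasure_sizeTop_eq_zero_of_tailBound {v : V} {p q : I} {A s : ℝ≥0∞} (hA : A ≠ ∞)
    (hs0 : s ≠ 0) (hs1 : s < 1) (h : TailBound G p v A s) (h0 : percMeasure G p (sizeTop G v) = 0)
    (hpq : p ≤ q) (hq : ENNReal.ofReal q ≤ s⁻¹ * ENNReal.ofReal p) :
    percMeasure G q (sizeTop G v) = 0 := by
  refine percMeasure_sizeTop_eq_zero (p := p) (N := 0) (g := fun m ↦ s⁻¹ ^ m) ?_ ?_
  · intro F ω _
    rw [← Finset.prod_const, ← Finset.prod_mul_distrib]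
    refine Finset.prod_le_prod' fun e _ ↦ ?_
    cases ω e
    · rw [edgeWeight_false, edgeWeight_false]
      have h1 : 1 ≤ s⁻¹ := ENNReal.one_le_inv.2 hs1.le
      refine le_trans ?_ (le_mul_of_one_le_left zero_le h1)
      exact ENNReal.ofReal_le_ofReal (sub_le_sub_left (show (p : ℝ) ≤ q from hpq) 1)
    · rwa [edgeWeight_true, edgeWeight_true]
  · have hle : ∑' m, s⁻¹ ^ m * percMeasure G p (sizeGE G v m) ≤ ∑' m, A * s ^ m := by
      refine ENNReal.tsum_le_tsum fun m ↦ ?_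
      -- Absence of percolation at p turns the bound on finite clusters into a bound on the full
      -- tail.
      rw [← measure_sdiff_null h0 (s := sizeGE G v m)]
      calc s⁻¹ ^ m * percMeasure G p (sizeGE G v m \ sizeTop G v)
          ≤ s⁻¹ ^ m * (A * s ^ (2 * m)) := by gcongr; exact h m
        _ = A * s ^ m * (s⁻¹ * s) ^ m := by ring
        _ = A * s ^ m := by
          rw [ENNReal.inv_mul_cancel hs0 (hs1.trans ENNReal.one_lt_top).ne, one_pow, mul_one]
    refine ne_top_of_le_ne_top ?_ hle
    rw [ENNReal.tsum_mul_left, ENNReal.tsum_geometric]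
    exact ENNReal.mul_ne_top hA (ENNReal.inv_ne_top.2 (tsub_pos_of_lt hs1).ne')

end FiniteVolume

/-! ### No percolation at small parameters. -/

section Small

variable {V : Type*} {G : SimpleGraph V} [G.LocallyFinite]

open scoped Classical in
lemma card_filter_mem_le (D : Finset G.edgeSet) (x : V) :
    (D.filter fun e ↦ x ∈ e.1).card ≤ G.degree x := by
  rw [← SimpleGraph.card_incidenceFinset_eq_degree]
  refine Finset.card_le_card_of_injOn Subtype.val ?_ Subtype.val_injective.injOn
  intro e he
  simp only [Finset.coe_filter, mem_ofPred_eq] at he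
  simpa [SimpleGraph.incidenceSet] using he.2

open scoped Classical in
/-- In a finite-volume cluster a positive fraction of the touching edges are open. -/
lemma card_truncEdges_le {d : ℕ} (hd : ∀ x, G.degree x ≤ d) (F : Finset G.edgeSet) (v : V)
    (ω : Config G) (h : d + 1 ≤ (truncEdges F v ω).card) :
    (truncEdges F v ω).card ≤ ((truncEdges F v ω).filter fun e ↦ ω e = true).card * (2 * d) := by
  set D := truncEdges F v ω with hD
  -- If the cluster were just {v}, at most d edges would touch it; this is why d + 1 is the
  -- threshold.
  obtain ⟨u, hu, huv⟩ : ∃ u ∈ cluster (trunc F ω) v, u ≠ v := by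
    by_contra! hcon
    have : D ⊆ D.filter fun e ↦ v ∈ e.1 := by
      intro e he
      obtain ⟨x, hx, hxe⟩ := (mem_truncEdges.1 he).2
      exact Finset.mem_filter.2 ⟨he, hcon x hx ▸ hxe⟩
    have := (Finset.card_le_card this).trans ((card_filter_mem_le D v).trans (hd v))
    omega
  -- Every cluster vertex lies on an open edge, and an open edge meets at most 2d edges of D.
  have hsub : D ⊆ (D.filter fun e ↦ ω e = true).biUnion
      fun o ↦ D.filter fun e ↦ ∃ x, x ∈ o.1 ∧ x ∈ e.1 := by
    intro e he
    obtain ⟨x, hx, hxe⟩ := (mem_truncEdges.1 he).2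
    obtain ⟨o, hxo, ho⟩ := exists_open_edge hu huv hx
    have hoF : o ∈ F := by
      by_contra hoF
      rw [trunc_of_notMem hoF] at ho
      exact absurd ho (by simp)
    rw [trunc_of_mem hoF] at ho
    exact Finset.mem_biUnion.2 ⟨o, Finset.mem_filter.2
      ⟨mem_truncEdges.2 ⟨hoF, x, hx, hxo⟩, ho⟩, Finset.mem_filter.2 ⟨he, x, hxo, hxe⟩⟩
  refine (Finset.card_le_card hsub).trans (Finset.card_biUnion_le_card_mul _ _ _ ?_)
  rintro ⟨o, ho⟩ -
  induction o with | _ a b =>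
  have : (D.filter fun e ↦ ∃ x, x ∈ s(a, b) ∧ x ∈ e.1) ⊆
      (D.filter fun e ↦ a ∈ e.1) ∪ (D.filter fun e ↦ b ∈ e.1) := by
    intro e he
    simp only [Finset.mem_filter, Finset.mem_union, Sym2.mem_iff] at he ⊢
    obtain ⟨he, x, rfl | rfl, hx⟩ := he
    · exact Or.inl ⟨he, hx⟩
    · exact Or.inr ⟨he, hx⟩
  refine (Finset.card_le_card this).trans ((Finset.card_union_le _ _).trans ?_)
  have := (card_filter_mem_le D a).trans (hd a)
  have := (card_filter_mem_le D b).trans (hd b)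
  omega

/-- There is no percolation at small values of the parameter. -/
lemma percMeasure_sizeTop_eq_zero_of_le [Countable V] {d : ℕ} (hd : ∀ x, G.degree x ≤ d) (v : V)
    {q : I} (hq : (q : ℝ) ≤ (1 / 4) ^ (2 * d)) : percMeasure G q (sizeTop G v) = 0 := by
  classical
  -- At parameter 1/2 every state of m edges has weight 2⁻¹ ^ m, so only the weight at q has to be
  -- estimated.
  let p : I := ⟨1 / 2, by norm_num, by norm_num⟩
  have hp (b : Bool) : edgeWeight p b = 2⁻¹ := by
    have : ENNReal.ofReal (1 / 2) = 2⁻¹ := by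
      rw [one_div, ENNReal.ofReal_inv_of_pos (by norm_num)]; simp
    cases b
    · rw [edgeWeight_false, ← this]; congr 1; norm_num [p]
    · rw [edgeWeight_true, ← this]
  have hq' : ENNReal.ofReal q ≤ 4⁻¹ ^ (2 * d) := by
    refine (ENNReal.ofReal_le_ofReal hq).trans_eq ?_
    rw [ENNReal.ofReal_pow (by norm_num), one_div, ENNReal.ofReal_inv_of_pos (by norm_num)]
    simp
  refine percMeasure_sizeTop_eq_zero (p := p) (N := d + 1) (g := fun m ↦ 2⁻¹ ^ m) ?_ ?_
  · intro F ω h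
    set D := truncEdges F v ω with hD
    have h1 : ∏ e ∈ D, edgeWeight p (ω e) = 2⁻¹ ^ D.card := by simp [hp]
    have h2 : ∏ e ∈ D, edgeWeight q (ω e) ≤
        ENNReal.ofReal q ^ (D.filter fun e ↦ ω e = true).card := by
      rw [← Finset.prod_filter_mul_prod_filter_not D (fun e ↦ ω e = true)]
      rw [← mul_one (_ ^ _)]
      refine mul_le_mul' ?_ (Finset.prod_le_one' fun e _ ↦ prob_le_one)
      rw [← Finset.prod_const]
      refine Finset.prod_le_prod' fun e he ↦ ?_
      rw [(Finset.mem_filter.1 he).2, edgeWeight_true]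
    rw [h1]
    calc _ ≤ _ := h2
      _ ≤ (4⁻¹ ^ (2 * d)) ^ (D.filter fun e ↦ ω e = true).card := by gcongr
      _ = 4⁻¹ ^ ((D.filter fun e ↦ ω e = true).card * (2 * d)) := by rw [← pow_mul, mul_comm]
      -- At least |D| / (2d) edges are open, and each contributes at most 4⁻¹ ^ (2d).
      _ ≤ 4⁻¹ ^ D.card := pow_le_pow_of_le_one zero_le (by simp [ENNReal.inv_le_one])
          (card_truncEdges_le hd F v ω h)
      _ = 2⁻¹ ^ D.card * 2⁻¹ ^ D.card := by
          rw [← mul_pow, ← ENNReal.mul_inv (by simp) (by simp)]; norm_num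
  · have hle : ∑' m, (2⁻¹ : ℝ≥0∞) ^ m * percMeasure G p (sizeGE G v m) ≤ ∑' m, 2⁻¹ ^ m :=
      ENNReal.tsum_le_tsum fun m ↦ mul_le_of_le_one_right zero_le prob_le_one
    refine ne_top_of_le_ne_top ?_ hle
    rw [ENNReal.tsum_geometric]
    simp

end Small

/-! ### Invariance under automorphisms. -/

section Invariance

variable {V : Type*} {G : SimpleGraph V}

lemma cluster_comp_iso (φ : G ≃g G) (ω : Config G) (v : V) :
    cluster (fun e ↦ ω (φ.mapEdgeSet e)) v = φ ⁻¹' cluster ω (φ v) := by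
  have hadj (a b : V) : (openSubgraph ω).Adj (φ a) (φ b) ↔
      (openSubgraph fun e ↦ ω (φ.mapEdgeSet e)).Adj a b := by
    rw [openSubgraph_adj, openSubgraph_adj]
    constructor
    · rintro ⟨h, ho⟩
      exact ⟨φ.map_adj_iff.1 h, ho⟩
    · rintro ⟨h, ho⟩
      exact ⟨φ.map_adj_iff.2 h, ho⟩
  let ψ : (openSubgraph fun e ↦ ω (φ.mapEdgeSet e)) ≃g openSubgraph ω :=
    ⟨φ.toEquiv, fun {a b} ↦ hadj a b⟩
  ext u
  exact (ψ.reachable_iff (u := v) (v := u)).symm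

lemma encard_clusterEdges_comp_iso (φ : G ≃g G) (ω : Config G) (v : V) :
    (clusterEdges (fun e ↦ ω (φ.mapEdgeSet e)) v).encard = (clusterEdges ω (φ v)).encard := by
  rw [encard_clusterEdges, encard_clusterEdges, cluster_comp_iso,
    ← φ.mapEdgeSet.injective.encard_image]
  congr 1
  ext e
  obtain ⟨e, rfl⟩ := φ.mapEdgeSet.surjective e
  rw [φ.mapEdgeSet.injective.mem_set_image]
  constructor
  · rintro ⟨u, hu, hue⟩
    exact ⟨φ u, hu, Sym2.mem_map.2 ⟨u, hue, rfl⟩⟩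
  · rintro ⟨u, hu, hue⟩
    obtain ⟨w, hw, rfl⟩ := Sym2.mem_map.1 hue
    exact ⟨w, hu, hw⟩

/-- An automorphism permutes the edges, and a product of identical factors is invariant under
permutations of the coordinates. -/
lemma percMeasure_comp_iso (φ : G ≃g G) (p : I) (v : V) (Q : ℕ∞ → Prop) :
    percMeasure G p {ω | Q (clusterEdges ω (φ v)).encard} =
      percMeasure G p {ω | Q (clusterEdges ω v).encard} := by
  have h := Measure.infinitePi_map_piCongrLeft
    (fun _ : G.edgeSet ↦ ProbabilityTheory.bernoulliMeasure true false p) φ.mapEdgeSet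
  have h' : percMeasure G p = (percMeasure G p).map
    (MeasurableEquiv.piCongrLeft (fun _ : G.edgeSet ↦ Bool) φ.mapEdgeSet) := h.symm
  conv_lhs => rw [h']
  rw [MeasurableEquiv.map_apply]
  congr 1
  ext ω
  simp only [mem_preimage, mem_ofPred_eq]
  rw [← encard_clusterEdges_comp_iso]
  have : (fun e ↦ (MeasurableEquiv.piCongrLeft (fun _ : G.edgeSet ↦ Bool) φ.mapEdgeSet) ω
      (φ.mapEdgeSet e)) = ω := by
    ext e
    exact Equiv.piCongrLeft_apply_apply (fun _ : G.edgeSet ↦ Bool) φ.mapEdgeSet ω e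
  rw [this]

lemma percMeasure_sizeTop_eq (htrans : IsTransitive G) (p : I) (u v : V) :
    percMeasure G p (sizeTop G u) = percMeasure G p (sizeTop G v) := by
  obtain ⟨φ, rfl⟩ := htrans v u
  exact percMeasure_comp_iso φ p v (· = ⊤)

lemma TailBound.of_isTransitive (htrans : IsTransitive G) {p : I} {v : V} {A s : ℝ≥0∞}
    (h : TailBound G p v A s) (u : V) : TailBound G p u A s := by
  obtain ⟨φ, rfl⟩ := htrans v u
  exact fun n ↦ (percMeasure_comp_iso φ p v (fun x ↦ (n : ℕ∞) ≤ x ∧ ¬ x = ⊤)).trans_le (h n)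

end Invariance

/-! ### Finite regions, their boundaries, and the double count. -/

section Boundary

variable {V : Type*} {G : SimpleGraph V}

lemma dependsOn_cluster_eq (C : Set V) (v : V) :
    DependsOn (· ∈ {ω : Config G | cluster ω v = C}) (touching G C) := by
  have key : ∀ ω η : Config G, (∀ e ∈ touching G C, ω e = η e) →
      cluster ω v = C → cluster η v = C := by
    rintro ω η h rfl
    exact cluster_eq_of_agree h
  intro ω η h
  exact propext ⟨key ω η h, key η ω fun e he ↦ (h e he).symm⟩

/-- A finite-volume cluster becomes a cluster when its boundary edges are closed. -/
lemma percMeasure_cluster_trunc_eq_le {F B : Finset G.edgeSet} {C : Set V} (hd : Disjoint F B)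
    (hB : ∀ e ∈ touching G C, e ∉ F → e ∈ B) (v : V) (p : I) :
    percMeasure G p {ω | cluster (trunc F ω) v = C} * edgeWeight p false ^ B.card ≤
      percMeasure G p {ω | cluster ω v = C} := by
  have hdep : DependsOn (· ∈ {ω : Config G | cluster (trunc F ω) v = C}) (F : Set G.edgeSet) :=
    dependsOn_trunc F (fun ω ↦ cluster ω v = C)
  rw [← percMeasure_inter_closed hdep hd]
  refine measure_mono ?_
  rintro ω ⟨rfl, hω⟩
  refine cluster_eq_of_agree fun e he ↦ ?_
  by_cases heF : e ∈ F
  · exact trunc_of_mem heF ω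
  · rw [trunc_of_notMem heF, hω e (hB e he heF)]

open scoped Classical in
lemma card_le_two_mul_card_touching (hE : ∀ x : V, ∃ e : G.edgeSet, x ∈ e.1) (C : Finset V)
    (T : Finset G.edgeSet) (hT : (T : Set G.edgeSet) = touching G C) : C.card ≤ T.card * 2 := by
  have hsub : C ⊆ T.biUnion fun e ↦ C.filter (· ∈ e.1) := by
    intro x hx
    obtain ⟨e, he⟩ := hE x
    have heT : e ∈ T := by
      rw [← Finset.mem_coe, hT]
      exact ⟨x, hx, he⟩
    exact Finset.mem_biUnion.2 ⟨e, heT, Finset.mem_filter.2 ⟨hx, he⟩⟩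
  refine (Finset.card_le_card hsub).trans (Finset.card_biUnion_le_card_mul _ _ _ ?_)
  rintro ⟨e, he⟩ -
  induction e with | _ a b =>
  have : C.filter (· ∈ s(a, b)) ⊆ {a, b} := by
    intro x hx
    simpa using (Finset.mem_filter.1 hx).2
  exact (Finset.card_le_card this).trans Finset.card_le_two

/-- The edges with both endpoints in `K`. -/
def innerEdges (G : SimpleGraph V) (K : Finset V) : Finset G.edgeSet :=
  K.sym2.preimage Subtype.val Subtype.val_injective.injOn

lemma mem_innerEdges {K : Finset V} {e : G.edgeSet} :
    e ∈ innerEdges G K ↔ ∀ a ∈ e.1, a ∈ K := by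
  simp [innerEdges, Finset.mem_sym2_iff]

lemma cluster_trunc_innerEdges_subset {K : Finset V} {v : V} (hv : v ∈ K) (ω : Config G) :
    cluster (trunc (innerEdges G K) ω) v ⊆ K := by
  refine (subset_cluster_of_agree (η := trunc (innerEdges G K) ω) (Finset.mem_coe.2 hv) ?_
    fun _ _ ↦ rfl).trans inter_subset_left
  intro a _ b hab
  obtain ⟨he, ho⟩ := openSubgraph_adj.1 hab
  by_contra hb
  have : (⟨s(a, b), he⟩ : G.edgeSet) ∉ innerEdges G K := fun h ↦
    hb (mem_innerEdges.1 h b (by simp))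
  rw [trunc_of_notMem this] at ho
  exact absurd ho (by simp)

variable [G.LocallyFinite]

lemma finite_touching (C : Finset V) : (touching G C).Finite := by
  classical
  refine Set.Finite.of_finite_image (f := Subtype.val) ?_ Subtype.val_injective.injOn
  refine (C.biUnion fun u ↦ G.incidenceFinset u).finite_toSet.subset ?_
  rintro _ ⟨e, ⟨u, hu, hue⟩, rfl⟩
  simp only [Finset.coe_biUnion, mem_iUnion]
  exact ⟨u, hu, by simpa [SimpleGraph.incidenceSet] using hue⟩

/-- The edges of `G` touching a finite set of vertices. -/
def touchingFinset (G : SimpleGraph V) [G.LocallyFinite] (C : Finset V) : Finset G.edgeSet :=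
  (finite_touching C).toFinset

lemma mem_touchingFinset {C : Finset V} {e : G.edgeSet} :
    e ∈ touchingFinset G C ↔ e ∈ touching G C := by
  simp [touchingFinset]

open scoped Classical in
/-- The edges with exactly one endpoint in `K`. -/
def boundaryFinset (G : SimpleGraph V) [G.LocallyFinite] (K : Finset V) : Finset G.edgeSet :=
  touchingFinset G K \ innerEdges G K

lemma mem_boundaryFinset {K : Finset V} {e : G.edgeSet} :
    e ∈ boundaryFinset G K ↔ ∃ x ∈ K, ∃ y ∉ K, e.1 = s(x, y) := by
  classical
  rw [boundaryFinset, Finset.mem_sdiff, mem_touchingFinset, mem_innerEdges]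
  obtain ⟨e, he⟩ := e
  induction e with | _ a b =>
  constructor
  · rintro ⟨⟨u, hu, hue⟩, h⟩
    have hu' : u ∈ K := hu
    simp only [Sym2.mem_iff, forall_eq_or_imp, forall_eq, not_and] at hue h
    rcases hue with rfl | rfl
    · exact ⟨u, hu', b, h hu', rfl⟩
    · exact ⟨u, hu', a, fun ha ↦ h ha hu', Sym2.eq_swap⟩
  · rintro ⟨x, hx, y, hy, h⟩
    simp only at h
    exact ⟨⟨x, hx, by simp [h]⟩, fun h' ↦ hy (h' y (by simp [h]))⟩

lemma card_boundaryFinset (K : Finset V) :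
    (boundaryFinset G K).card = (edgeBoundary G (K : Set V)).ncard := by
  classical
  rw [← Finset.card_map (Function.Embedding.subtype _), ← ncard_coe_finset]
  congr 1
  ext e
  simp only [Finset.coe_map, Function.Embedding.subtype_apply, mem_image, Finset.mem_coe,
    mem_boundaryFinset, edgeBoundary, mem_ofPred_eq]
  constructor
  · rintro ⟨e, h, rfl⟩
    exact ⟨e.2, h⟩
  · rintro ⟨he, h⟩
    exact ⟨⟨e, he⟩, h, rfl⟩

open scoped Classical in
/-- The finite-volume clusters of the vertices of `K` are rarely much smaller than their
boundary. -/
lemma card_bad_le (K : Finset V) (ω : Config G) (L : ℕ) :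
    (K.filter fun v ↦ (K.filter (· ∈ cluster (trunc (innerEdges G K) ω) v)).card <
      L * ((boundaryFinset G K).filter
        (· ∈ touching G (cluster (trunc (innerEdges G K) ω) v))).card).card ≤
      L * (boundaryFinset G K).card := by
  set η := trunc (innerEdges G K) ω with hη
  set N : V → ℕ := fun v ↦ (K.filter (· ∈ cluster η v)).card with hN
  set b : V → ℕ := fun v ↦ ((boundaryFinset G K).filter (· ∈ touching G (cluster η v))).card
    with hb
  have hNpos : ∀ v ∈ K, 0 < N v := fun v hv ↦
    Finset.card_pos.2 ⟨v, Finset.mem_filter.2 ⟨hv, mem_cluster_self _ _⟩⟩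
  -- Exchange the sums: a boundary edge has one endpoint x in K and is counted with weight 1 / N x
  -- by each of the N x vertices in the cluster of x, hence 1 in total.
  have hsum : ∑ v ∈ K, (b v : ℚ) / N v ≤ (boundaryFinset G K).card := by
    have h1 : ∀ v, (b v : ℚ) / N v =
        ∑ e ∈ boundaryFinset G K, if e ∈ touching G (cluster η v) then 1 / (N v : ℚ) else 0 := by
      intro v
      rw [← Finset.sum_filter, Finset.sum_const, nsmul_eq_mul, mul_one_div]
    simp_rw [h1]
    rw [Finset.sum_comm, ← nsmul_one (Finset.card _), ← Finset.sum_const]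
    refine Finset.sum_le_sum fun e he ↦ ?_
    obtain ⟨x, hx, y, hy, hxy⟩ := mem_boundaryFinset.1 he
    have h2 : ∀ v ∈ K, (if e ∈ touching G (cluster η v) then 1 / (N v : ℚ) else 0) =
        if v ∈ cluster η x then 1 / (N x : ℚ) else 0 := by
      intro v hv
      have h3 : e ∈ touching G (cluster η v) ↔ v ∈ cluster η x := by
        constructor
        · rintro ⟨u, hu, hue⟩
          rw [hxy, Sym2.mem_iff] at hue
          rcases hue with rfl | rfl
          · exact SimpleGraph.Reachable.symm hu
          · exact absurd (cluster_trunc_innerEdges_subset hv ω hu) hy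
        · exact fun h ↦ ⟨x, SimpleGraph.Reachable.symm h, by rw [hxy]; simp⟩
      by_cases h : v ∈ cluster η x
      · rw [if_pos (h3.2 h), if_pos h]
        simp only [hN, cluster_eq_of_mem h]
      · rw [if_neg fun h' ↦ h (h3.1 h'), if_neg h]
    rw [Finset.sum_congr rfl h2, ← Finset.sum_filter, Finset.sum_const, nsmul_eq_mul]
    have : (N x : ℚ) ≠ 0 := by exact_mod_cast (hNpos x hx).ne'
    exact (mul_one_div_cancel this).le
  -- Markov's inequality: a bad vertex has L * b / N ≥ 1.
  have hcard : ((K.filter fun v ↦ N v < L * b v).card : ℚ) ≤ ∑ v ∈ K, (L : ℚ) * (b v / N v) := by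
    rw [← nsmul_one, ← Finset.sum_const, Finset.sum_filter]
    refine Finset.sum_le_sum fun v hv ↦ ?_
    have hp : (0 : ℚ) < N v := by exact_mod_cast hNpos v hv
    split_ifs with h
    · rw [← mul_div_assoc, one_le_div hp]
      exact_mod_cast h.le
    · positivity
  rw [← Finset.mul_sum] at hcard
  have : ((K.filter fun v ↦ N v < L * b v).card : ℚ) ≤ L * (boundaryFinset G K).card :=
    hcard.trans (mul_le_mul_of_nonneg_left hsum (by positivity))
  exact_mod_cast this

end Boundary

/-! ### The percolating regime on an amenable graph. -/

section Amenable

variable {V : Type*} {G : SimpleGraph V} [G.LocallyFinite]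

lemma measurableSet_cluster_eq (C : Finset V) (v : V) :
    MeasurableSet {ω : Config G | cluster ω v = C} := by
  refine measurableSet_of_dependsOn (F := touchingFinset G C) ?_
  rw [touchingFinset, Finite.coe_toFinset]
  exact dependsOn_cluster_eq _ v

-- Price of the surgery: closing the boundary edges that touch C is independent of the inside of K,
-- and each closure has probability at least s ^ l.
open scoped Classical in
lemma percMeasure_cluster_trunc_eq_le_of_card {K C : Finset V} (hCK : C ⊆ K) {p : I} {s : ℝ≥0∞}
    (hs0 : s ≠ 0) (hs1 : s < 1) {l m : ℕ} (hl : s ^ l ≤ edgeWeight p false)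
    (hm : l * ((boundaryFinset G K).filter (· ∈ touching G (C : Set V))).card ≤ m) (v : V) :
    percMeasure G p {ω | cluster (trunc (innerEdges G K) ω) v = C} ≤
      s⁻¹ ^ m * percMeasure G p {ω | cluster ω v = C} := by
  set B := (boundaryFinset G K).filter (· ∈ touching G (C : Set V)) with hB
  have hd : Disjoint (innerEdges G K) B := by
    refine Finset.disjoint_left.2 fun e he he' ↦ ?_
    exact (Finset.mem_sdiff.1 (Finset.mem_filter.1 he').1).2 he
  have hclosed := percMeasure_cluster_trunc_eq_le (C := (C : Set V)) hd (fun e he heF ↦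
    Finset.mem_filter.2 ⟨Finset.mem_sdiff.2 ⟨mem_touchingFinset.2
      (touching_mono (Finset.coe_subset.2 hCK) he), heF⟩, he⟩) v p
  have hw : s ^ m ≤ edgeWeight p false ^ B.card :=
    calc s ^ m ≤ s ^ (l * B.card) := pow_le_pow_of_le_one zero_le hs1.le hm
      _ = (s ^ l) ^ B.card := pow_mul _ _ _
      _ ≤ edgeWeight p false ^ B.card := by gcongr
  have hst : s ≠ ∞ := (hs1.trans ENNReal.one_lt_top).ne
  calc _ = (s⁻¹ * s) ^ m * percMeasure G p {ω | cluster (trunc (innerEdges G K) ω) v = C} := by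
        rw [ENNReal.inv_mul_cancel hs0 hst, one_pow, one_mul]
    _ = s⁻¹ ^ m * (percMeasure G p {ω | cluster (trunc (innerEdges G K) ω) v = C} * s ^ m) := by
        ring
    _ ≤ s⁻¹ ^ m * percMeasure G p {ω | cluster ω v = C} := by
        gcongr
        exact (mul_le_mul_right hw _).trans hclosed

-- Sum the surgery bound over the possible clusters C with m touching edges. As |C| ≤ 2m, the
-- condition 2lb ≤ |C| gives lb ≤ m, so the cost is at most s⁻¹ ^ m against the tail A * s ^ (2 *
-- m). As b ≥ 1, only m ≥ l occur.
open scoped Classical in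
lemma percMeasure_good_le (hE : ∀ x : V, ∃ e : G.edgeSet, x ∈ e.1) {K : Finset V} {v : V}
    (hv : v ∈ K) {p : I} {A s : ℝ≥0∞} (hs0 : s ≠ 0) (hs1 : s < 1) {l : ℕ}
    (hl : s ^ l ≤ edgeWeight p false) (h : TailBound G p v A s) :
    percMeasure G p {ω |
      1 ≤ ((boundaryFinset G K).filter
        (· ∈ touching G (cluster (trunc (innerEdges G K) ω) v))).card ∧
      2 * l * ((boundaryFinset G K).filter
        (· ∈ touching G (cluster (trunc (innerEdges G K) ω) v))).card ≤
        (K.filter (· ∈ cluster (trunc (innerEdges G K) ω) v)).card} ≤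
      ∑' k, A * s ^ (k + l) := by
  set b : Set V → ℕ := fun C ↦ ((boundaryFinset G K).filter (· ∈ touching G C)).card with hb
  set 𝒞 : ℕ → Finset (Finset V) := fun m ↦ K.powerset.filter fun C ↦
    l * b C ≤ m ∧ (touchingFinset G C).card = m with h𝒞
  have hsub : {ω : Config G | 1 ≤ b (cluster (trunc (innerEdges G K) ω) v) ∧
      2 * l * b (cluster (trunc (innerEdges G K) ω) v) ≤
        (K.filter (· ∈ cluster (trunc (innerEdges G K) ω) v)).card} ⊆
      ⋃ k, ⋃ C ∈ 𝒞 (k + l), {ω | cluster (trunc (innerEdges G K) ω) v = C} := by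
    rintro ω ⟨h1, h2⟩
    set C := K.filter (· ∈ cluster (trunc (innerEdges G K) ω) v) with hC
    have hcl : cluster (trunc (innerEdges G K) ω) v = C := by
      ext x
      simp only [hC, Finset.coe_filter, mem_ofPred_eq]
      exact ⟨fun hx ↦ ⟨cluster_trunc_innerEdges_subset hv ω hx, hx⟩, fun hx ↦ hx.2⟩
    rw [hcl] at h1 h2
    have h3 := card_le_two_mul_card_touching hE C (touchingFinset G C)
      (by rw [touchingFinset, Finite.coe_toFinset])
    have h4 : l * b C ≤ (touchingFinset G C).card := by
      rw [mul_assoc] at h2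
      omega
    have h5 : l ≤ (touchingFinset G C).card := le_trans (Nat.le_mul_of_pos_right l h1) h4
    obtain ⟨k, hk⟩ := Nat.exists_eq_add_of_le' h5
    exact mem_iUnion.2 ⟨k, mem_iUnion₂.2 ⟨C, Finset.mem_filter.2
      ⟨Finset.mem_powerset.2 (Finset.filter_subset _ _), hk ▸ h4, hk⟩, hcl⟩⟩
  refine (measure_mono hsub).trans ((measure_iUnion_le _).trans (ENNReal.tsum_le_tsum fun k ↦ ?_))
  set m := k + l
  have hdisj : (𝒞 m : Set (Finset V)).PairwiseDisjoint
      fun C ↦ {ω : Config G | cluster ω v = C} := by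
    intro C _ D _ hCD
    refine Set.disjoint_left.2 fun ω h h' ↦ hCD (Finset.coe_injective ?_)
    exact (show cluster ω v = C from h).symm.trans h'
  calc percMeasure G p (⋃ C ∈ 𝒞 m, {ω | cluster (trunc (innerEdges G K) ω) v = C})
      ≤ ∑ C ∈ 𝒞 m, percMeasure G p {ω | cluster (trunc (innerEdges G K) ω) v = C} :=
        measure_biUnion_finset_le _ _
    _ ≤ ∑ C ∈ 𝒞 m, s⁻¹ ^ m * percMeasure G p {ω | cluster ω v = C} := by
        refine Finset.sum_le_sum fun C hC ↦ ?_
        obtain ⟨hCK, hC1, -⟩ := Finset.mem_filter.1 hC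
        exact percMeasure_cluster_trunc_eq_le_of_card (Finset.mem_powerset.1 hCK) hs0 hs1 hl hC1 v
    _ = s⁻¹ ^ m * percMeasure G p (⋃ C ∈ 𝒞 m, {ω | cluster ω v = C}) := by
        rw [← Finset.mul_sum, measure_biUnion_finset hdisj fun C _ ↦ measurableSet_cluster_eq C v]
    _ ≤ s⁻¹ ^ m * percMeasure G p (sizeGE G v m \ sizeTop G v) := by
        gcongr
        intro ω hω
        obtain ⟨C, hC, hωC⟩ := mem_iUnion₂.1 hω
        have hωC' : cluster ω v = C := hωC
        have hcard : (clusterEdges ω v).encard = m := by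
          rw [encard_clusterEdges, hωC', ← (Finset.mem_filter.1 hC).2.2,
            ← encard_coe_eq_coe_finsetCard, touchingFinset, Finite.coe_toFinset]
        exact ⟨hcard.ge, fun htop ↦ ENat.natCast_ne_top m (hcard.symm.trans htop)⟩
    _ ≤ s⁻¹ ^ m * (A * s ^ (2 * m)) := by gcongr; exact h m
    _ = A * s ^ m * (s⁻¹ * s) ^ m := by ring
    _ = A * s ^ m := by
        rw [ENNReal.inv_mul_cancel hs0 (hs1.trans ENNReal.one_lt_top).ne, one_pow, mul_one]

open scoped Classical in
/-- An infinite cluster leaves every finite set of vertices. -/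
lemma one_le_card_boundary_of_mem_sizeTop {K : Finset V} {v : V} {ω : Config G}
    (hv : v ∈ K) (hω : ω ∈ sizeTop G v) : 1 ≤ ((boundaryFinset G K).filter
      (· ∈ touching G (cluster (trunc (innerEdges G K) ω) v))).card := by
  by_contra! hlt
  have hempty := Finset.card_eq_zero.1 (Nat.lt_one_iff.1 hlt)
  have hsub : touching G (cluster (trunc (innerEdges G K) ω) v) ⊆ innerEdges G K := by
    intro e he
    by_contra heF
    have : e ∈ (boundaryFinset G K).filter
        (· ∈ touching G (cluster (trunc (innerEdges G K) ω) v)) :=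
      Finset.mem_filter.2 ⟨Finset.mem_sdiff.2 ⟨mem_touchingFinset.2
        (touching_mono (cluster_trunc_innerEdges_subset hv ω) he), heF⟩, he⟩
    rw [hempty] at this
    exact absurd this (Finset.notMem_empty e)
  have hcl : cluster ω v = cluster (trunc (innerEdges G K) ω) v :=
    cluster_eq_of_agree fun e he ↦ trunc_of_mem (hsub he) ω
  have htop : (touching G (cluster ω v)).encard = ⊤ :=
    (encard_clusterEdges ω v).symm.trans hω
  rw [hcl] at htop
  exact encard_eq_top_iff.1 htop ((innerEdges G K).finite_toSet.subset hsub)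

/-- Averaging over K, with transitivity making all vertices equivalent: a vertex with an infinite
cluster is good or bad, and the expected number of bad ones is at most 2l|∂K|. -/
lemma mul_card_le_of_tailBound [Countable V] (htrans : IsTransitive G)
    (hE : ∀ x : V, ∃ e : G.edgeSet, x ∈ e.1) {p : I} {v : V} {A s : ℝ≥0∞} (hs0 : s ≠ 0)
    (hs1 : s < 1) {l : ℕ} (hl : s ^ l ≤ edgeWeight p false) (h : TailBound G p v A s)
    (K : Finset V) :
    K.card * percMeasure G p (sizeTop G v) ≤
      K.card * (∑' k, A * s ^ (k + l)) + (2 * l * (boundaryFinset G K).card : ℕ) := by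
  classical
  set F := innerEdges G K with hF
  set b : V → Config G → ℕ := fun u ω ↦ ((boundaryFinset G K).filter
    (· ∈ touching G (cluster (trunc F ω) u))).card with hb
  set N : V → Config G → ℕ := fun u ω ↦ (K.filter (· ∈ cluster (trunc F ω) u)).card with hN
  have hmeas (u : V) : MeasurableSet {ω | N u ω < 2 * l * b u ω} :=
    measurableSet_of_dependsOn (F := F) (dependsOn_trunc F fun ω ↦
      (K.filter (· ∈ cluster ω u)).card < 2 * l * ((boundaryFinset G K).filter
        (· ∈ touching G (cluster ω u))).card)
  have hbad : ∑ u ∈ K, percMeasure G p {ω | N u ω < 2 * l * b u ω} ≤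
      (2 * l * (boundaryFinset G K).card : ℕ) := by
    calc ∑ u ∈ K, percMeasure G p {ω | N u ω < 2 * l * b u ω}
        = ∫⁻ ω, ∑ u ∈ K, {ω | N u ω < 2 * l * b u ω}.indicator 1 ω ∂(percMeasure G p) := by
          rw [lintegral_finsetSum _ fun u _ ↦ measurable_one.indicator (hmeas u)]
          exact Finset.sum_congr rfl fun u _ ↦ (lintegral_indicator_one (hmeas u)).symm
      _ ≤ ∫⁻ ω, ((2 * l * (boundaryFinset G K).card : ℕ) : ℝ≥0∞) ∂(percMeasure G p) := by
          refine lintegral_mono fun ω ↦ ?_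
          have h1 : ∑ u ∈ K, {ω | N u ω < 2 * l * b u ω}.indicator (1 : Config G → ℝ≥0∞) ω =
              ((K.filter fun u ↦ N u ω < 2 * l * b u ω).card : ℕ) := by
            simp [indicator_apply]
          rw [h1]
          exact Nat.cast_le.2 (card_bad_le K ω (2 * l))
      _ = _ := by simp
  calc K.card * percMeasure G p (sizeTop G v)
      = ∑ u ∈ K, percMeasure G p (sizeTop G u) := by
        rw [Finset.sum_congr rfl fun u _ ↦ percMeasure_sizeTop_eq htrans p u v]
        simp
    _ ≤ ∑ u ∈ K, (∑' k, A * s ^ (k + l) + percMeasure G p {ω | N u ω < 2 * l * b u ω}) := by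
        refine Finset.sum_le_sum fun u hu ↦ ?_
        refine le_trans (measure_mono ?_) ((measure_union_le _ _).trans (add_le_add_left
          (percMeasure_good_le hE hu hs0 hs1 hl (h.of_isTransitive htrans u)) _))
        intro ω hω
        rcases lt_or_ge (N u ω) (2 * l * b u ω) with hlt | hge
        · exact Or.inr hlt
        · exact Or.inl ⟨one_le_card_boundary_of_mem_sizeTop hu hω, hge⟩
    _ ≤ _ := by
        rw [Finset.sum_add_distrib, Finset.sum_const, nsmul_eq_mul]
        gcongr

/-- Amenable transitive graphs have Følner sets. -/
lemma exists_boundary_le (htrans : IsTransitive G) (hamen : IsAmenable G) (v : V)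
    (hE : ∀ x : V, ∃ e : G.edgeSet, x ∈ e.1) {ε : ℝ} (hε : 0 < ε) :
    ∃ K : Finset V, K.Nonempty ∧ ((boundaryFinset G K).card : ℝ) ≤ ε * K.card := by
  have hdeg (x : V) : G.degree x = G.degree v := by
    obtain ⟨φ, rfl⟩ := htrans v x
    exact φ.degree_eq v
  -- A positive degree rules out the convention 0/0 = 0, under which a small Cheeger ratio would say
  -- nothing.
  have hpos : 0 < G.degree v := by
    obtain ⟨e, he⟩ := hE v
    rw [SimpleGraph.degree_pos_iff_exists_adj]
    obtain ⟨y, hy⟩ := Sym2.mem_iff_exists.1 he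
    exact ⟨y, by rw [← SimpleGraph.mem_edgeSet, ← hy]; exact e.2⟩
  have hd : (0 : ℝ) < G.degree v := by exact_mod_cast hpos
  have : Nonempty {K : Finset V // K.Nonempty} := ⟨{v}, Finset.singleton_nonempty v⟩
  have hlt : cheegerConst G < ε / G.degree v := (not_lt.1 hamen).trans_lt (div_pos hε hd)
  obtain ⟨⟨K, hK⟩, hKlt⟩ := exists_lt_of_ciInf_lt hlt
  refine ⟨K, hK, ?_⟩
  simp only [Finset.sum_congr rfl fun x _ ↦ hdeg x, Finset.sum_const, smul_eq_mul,
    Nat.cast_mul] at hKlt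
  have hKc : (0 : ℝ) < K.card := by exact_mod_cast hK.card_pos
  rw [div_lt_div_iff₀ (mul_pos hKc hd) hd] at hKlt
  rw [card_boundaryFinset]
  nlinarith

/-- On a transitive amenable graph the finite clusters do not have an exponential tail in the
percolating regime. -/
lemma not_tailBound_of_percolates [Countable V] (htrans : IsTransitive G) (hamen : IsAmenable G)
    (hE : ∀ x : V, ∃ e : G.edgeSet, x ∈ e.1) {p : I} (hp : p < 1) {v : V} {A s : ℝ≥0∞}
    (hA : A ≠ ∞) (hs0 : s ≠ 0) (hs1 : s < 1) (hθ : percMeasure G p (sizeTop G v) ≠ 0) :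
    ¬ TailBound G p v A s := by
  intro h
  refine hθ (le_antisymm ?_ zero_le)
  have hsum : ∑' k, A * s ^ k ≠ ∞ := by
    rw [ENNReal.tsum_mul_left, ENNReal.tsum_geometric]
    exact ENNReal.mul_ne_top hA (ENNReal.inv_ne_top.2 (tsub_pos_of_lt hs1).ne')
  have hw : 0 < edgeWeight p false := by
    rw [edgeWeight_false, ENNReal.ofReal_pos]
    exact sub_pos.2 (show (p : ℝ) < 1 from hp)
  have hev : ∀ᶠ l : ℕ in Filter.atTop, s ^ l ≤ edgeWeight p false :=
    ((ENNReal.tendsto_pow_atTop_nhds_zero_of_lt_one hs1).eventually_lt_const hw).mono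
      fun _ h ↦ h.le
  refine ge_of_tendsto (ENNReal.tendsto_sum_nat_add (fun k ↦ A * s ^ k) hsum) ?_
  filter_upwards [hev, Filter.eventually_gt_atTop 0] with l hl hl0
  refine ENNReal.le_of_forall_pos_le_add fun ε hε _ ↦ ?_
  have hl' : (0 : ℝ) < 2 * l := by positivity
  -- K is chosen after l, so that the bad vertices have density at most ε.
  obtain ⟨K, hK, hKε⟩ := exists_boundary_le htrans hamen v hE
    (div_pos (NNReal.coe_pos.2 hε) hl')
  have hb : ((2 * l * (boundaryFinset G K).card : ℕ) : ℝ≥0∞) ≤ K.card * ε := by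
    have : ((2 * l * (boundaryFinset G K).card : ℕ) : ℝ) ≤ K.card * ε := by
      push_cast
      calc 2 * (l : ℝ) * (boundaryFinset G K).card ≤ 2 * l * (ε / (2 * l) * K.card) := by gcongr
        _ = K.card * ε := by field_simp
    have h' : ((2 * l * (boundaryFinset G K).card : ℕ) : ℝ≥0) ≤ K.card * ε := by
      exact_mod_cast this
    exact_mod_cast h'
  have hmain := (mul_card_le_of_tailBound htrans hE hs0 hs1 hl h K).trans (add_le_add_right hb _)
  rw [← mul_add] at hmain
  exact (ENNReal.mul_le_mul_iff_right (by exact_mod_cast hK.card_pos.ne')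
    (ENNReal.natCast_ne_top _)).1 hmain

end Amenable

/-! ### Critical parameter, and tail bounds from the decay rate. -/

section Final

variable {V : Type*} {G : SimpleGraph V}

lemma countable_of_connected [G.LocallyFinite] (hconn : G.Connected) : Countable V := by
  obtain ⟨v⟩ := hconn.nonempty
  let B : ℕ → Set V := fun n ↦ Nat.rec {v} (fun _ S ↦ ⋃ x ∈ S, G.neighborSet x) n
  have hB (n : ℕ) : (B n).Countable := by
    induction n with
    | zero => exact countable_singleton v
    | succ n ih => exact ih.biUnion fun x _ ↦ (Set.toFinite (G.neighborSet x)).countable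
  refine countable_univ_iff.1 ((countable_iUnion hB).mono fun u _ ↦ ?_)
  have hu := hconn.preconnected v u
  rw [SimpleGraph.reachable_iff_reflTransGen] at hu
  induction hu with
  | refl => exact mem_iUnion.2 ⟨0, rfl⟩
  | @tail a b _ hab ih =>
    obtain ⟨n, hn⟩ := mem_iUnion.1 (ih trivial)
    exact mem_iUnion.2 ⟨n + 1, mem_iUnion₂.2 ⟨a, hn, hab⟩⟩

lemma exists_percMeasure_sizeTop_ne_zero [Countable V] {p : I}
    (h : ∀ᵐ ω ∂(percMeasure G p), ∃ v : V, (cluster ω v).Infinite) :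
    ∃ v, percMeasure G p (sizeTop G v) ≠ 0 := by
  by_contra! hcon
  have h0 : percMeasure G p (⋃ v, sizeTop G v) = 0 := measure_iUnion_null hcon
  have h1 : percMeasure G p univ = 0 := by
    rw [← nonpos_iff_eq_zero, ← h0]
    refine measure_mono_ae ?_
    filter_upwards [h] with ω hω _
    obtain ⟨v, hv⟩ := hω
    exact mem_iUnion.2 ⟨v, encard_clusterEdges_of_infinite hv⟩
  rw [measure_univ] at h1
  exact one_ne_zero h1

/-- Above the critical probability there is percolation. -/
lemma percMeasure_sizeTop_ne_zero_of_lt [Countable V] (htrans : IsTransitive G) {p : I}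
    (hp : criticalProb G < p) (v : V) : percMeasure G p (sizeTop G v) ≠ 0 := by
  obtain ⟨q, hq, hqp⟩ := sInf_lt_iff.1 hp
  obtain ⟨u, hu⟩ := exists_percMeasure_sizeTop_ne_zero hq
  rw [percMeasure_sizeTop_eq htrans p v u]
  exact (lt_of_lt_of_le (pos_iff_ne_zero.2 hu)
    (percMeasure_mono (measurableSet_sizeTop u) (isUpperSet_sizeTop u) hqp.le)).ne'

lemma le_criticalProb [Countable V] (htrans : IsTransitive G) (v : V) {p : I}
    (h : ∀ q ≤ p, percMeasure G q (sizeTop G v) = 0) : p ≤ criticalProb G :=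
  le_of_not_gt fun hlt ↦ percMeasure_sizeTop_ne_zero_of_lt htrans hlt v (h p le_rfl)

lemma criticalProb_pos [G.LocallyFinite] [Countable V] (htrans : IsTransitive G) (v : V) :
    0 < criticalProb G := by
  have hdeg (x : V) : G.degree x ≤ G.degree v := by
    obtain ⟨φ, rfl⟩ := htrans v x
    exact (φ.degree_eq v).le
  let q : I := ⟨(1 / 4) ^ (2 * G.degree v), by positivity,
    pow_le_one₀ (by norm_num) (by norm_num)⟩
  have hq : 0 < q := by
    change (0 : ℝ) < (1 / 4) ^ (2 * G.degree v)
    positivity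
  exact hq.trans_le (le_criticalProb htrans v fun r hr ↦
    percMeasure_sizeTop_eq_zero_of_le hdeg v hr)

/-- If there is no percolation at the critical probability, then the cluster size does not have
an exponential tail there. -/
lemma not_tailBound_criticalProb [G.LocallyFinite] [Countable V] (htrans : IsTransitive G) {v : V}
    (hp1 : criticalProb G < 1) {A s : ℝ≥0∞} (hA : A ≠ ∞) (hs0 : s ≠ 0) (hs1 : s < 1)
    (h0 : percMeasure G (criticalProb G) (sizeTop G v) = 0) :
    ¬ TailBound G (criticalProb G) v A s := by
  intro h
  have hpos := criticalProb_pos htrans v (G := G)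
  set p := criticalProb G with hp
  have hpE : 0 < ENNReal.ofReal p := ENNReal.ofReal_pos.2 hpos
  -- The largest parameter allowed by the comparison, capped at 1; it exceeds p because 0 < p < 1
  -- and s < 1.
  set x : ℝ≥0∞ := min 1 (s⁻¹ * ENNReal.ofReal p) with hx
  have hx1 : x ≤ 1 := min_le_left _ _
  have hxt : x ≠ ∞ := ne_top_of_le_ne_top ENNReal.one_ne_top hx1
  have hpx : ENNReal.ofReal p < x := by
    refine lt_min ?_ ?_
    · rw [← ENNReal.ofReal_one]
      exact (ENNReal.ofReal_lt_ofReal_iff one_pos).2 hp1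
    · conv_lhs => rw [← one_mul (ENNReal.ofReal p)]
      exact (ENNReal.mul_lt_mul_iff_left hpE.ne' ENNReal.ofReal_ne_top).2 (ENNReal.one_lt_inv.2 hs1)
  let q : I := ⟨x.toReal, ENNReal.toReal_nonneg, by
    simpa using ENNReal.toReal_mono ENNReal.one_ne_top hx1⟩
  have hpq : p < q := by
    change (p : ℝ) < x.toReal
    rwa [ENNReal.ofReal_lt_iff_lt_toReal p.2.1 hxt] at hpx
  have hqx : ENNReal.ofReal q = x := ENNReal.ofReal_toReal hxt
  have hq0 : percMeasure G q (sizeTop G v) = 0 :=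
    percMeasure_sizeTop_eq_zero_of_tailBound hA hs0 hs1 h h0 hpq.le (hqx.trans_le (min_le_right _ _))
  exact percMeasure_sizeTop_ne_zero_of_lt htrans hpq v hq0

lemma zeta_nonneg (p : I) (v : V) : 0 ≤ zeta G p v := by
  rw [zeta, EReal.neg_nonneg]
  refine Filter.limsup_le_of_le (h := Filter.Eventually.of_forall fun n ↦ ?_)
  refine mul_nonpos_of_nonneg_of_nonpos ?_ (ENNReal.log_le_zero_iff.2 prob_le_one)
  exact_mod_cast (by positivity : (0 : ℝ) ≤ 1 / n)

lemma exists_tailBound_of_zeta_ne_zero {p : I} {v : V} (h : zeta G p v ≠ 0) :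
    ∃ A s : ℝ≥0∞, A ≠ ∞ ∧ s ≠ 0 ∧ s < 1 ∧ TailBound G p v A s := by
  have hpos : 0 < zeta G p v := lt_of_le_of_ne (zeta_nonneg p v) h.symm
  rw [zeta, EReal.lt_neg_comm, neg_zero] at hpos
  obtain ⟨x, hlx, hx0⟩ := EReal.lt_iff_exists_real_btwn.1 hpos
  have hx : x < 0 := by exact_mod_cast hx0
  obtain ⟨n₀, hn₀⟩ := Filter.eventually_atTop.1
    ((Filter.eventually_lt_of_limsup_lt hlx).and (Filter.eventually_gt_atTop 0))
  -- x / 2 makes s ^ (2 * n) equal to exp(x * n), the decay given by the limsup.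
  set s : ℝ≥0∞ := ENNReal.ofReal (Real.exp (x / 2)) with hs
  have hs0 : s ≠ 0 := (ENNReal.ofReal_pos.2 (Real.exp_pos _)).ne'
  have hs1 : s < 1 := by
    rw [hs, ENNReal.ofReal_lt_one, Real.exp_lt_one_iff]
    linarith
  have hpow (n : ℕ) : s ^ (2 * n) = ENNReal.ofReal (Real.exp (x * n)) := by
    rw [hs, ← ENNReal.ofReal_pow (Real.exp_pos _).le, ← Real.exp_nat_mul]
    congr 2
    push_cast
    ring
  have hset (n : ℕ) : {ω : Config G | (n : ℕ∞) ≤ (clusterEdges ω v).encard ∧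
      (clusterEdges ω v).encard < ⊤} = sizeGE G v n \ sizeTop G v := by
    ext ω
    exact and_congr_right fun _ ↦ lt_top_iff_ne_top
  -- This value of A makes the bound trivial for n < n₀.
  refine ⟨(s ^ (2 * n₀))⁻¹, s, ENNReal.inv_ne_top.2 (pow_ne_zero _ hs0), hs0, hs1, fun n ↦ ?_⟩
  rcases lt_or_ge n n₀ with hn | hn
  · calc percMeasure G p (sizeGE G v n \ sizeTop G v) ≤ 1 := prob_le_one
      _ = (s ^ (2 * n₀))⁻¹ * s ^ (2 * n₀) := (ENNReal.inv_mul_cancel (pow_ne_zero _ hs0)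
          (ENNReal.pow_ne_top (hs1.trans ENNReal.one_lt_top).ne)).symm
      _ ≤ (s ^ (2 * n₀))⁻¹ * s ^ (2 * n) := by
          exact mul_le_mul_right (pow_le_pow_of_le_one zero_le hs1.le (by omega)) _
  · obtain ⟨hlt, hnpos⟩ := hn₀ n hn
    rw [hset] at hlt
    have h1 : percMeasure G p (sizeGE G v n \ sizeTop G v) ≤ s ^ (2 * n) := by
      have htop : percMeasure G p (sizeGE G v n \ sizeTop G v) ≠ ∞ := measure_ne_top _ _
      rcases eq_or_ne (percMeasure G p (sizeGE G v n \ sizeTop G v)) 0 with h0 | h0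
      · rw [h0]; exact zero_le
      · have hr := ENNReal.toReal_pos h0 htop
        rw [ENNReal.log_pos_real h0 htop] at hlt
        have hlt' : (1 / n : ℝ) *
            Real.log (percMeasure G p (sizeGE G v n \ sizeTop G v)).toReal < x := by
          exact_mod_cast hlt
        have hn' : (0 : ℝ) < n := by exact_mod_cast hnpos
        rw [one_div_mul_eq_div, div_lt_iff₀ hn', Real.log_lt_iff_lt_exp hr] at hlt'
        rw [hpow, ← ENNReal.ofReal_toReal htop]
        exact ENNReal.ofReal_le_ofReal hlt'.le
    refine h1.trans (le_mul_of_one_le_left zero_le ?_)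
    exact ENNReal.one_le_inv.2 (pow_le_one₀ zero_le hs1.le)

/-- A graph that percolates has edges at every vertex, by transitivity. -/
lemma exists_edge_of_percolates (htrans : IsTransitive G) {p : I} {v : V}
    (h : percMeasure G p (sizeTop G v) ≠ 0) (x : V) : ∃ e : G.edgeSet, x ∈ e.1 := by
  obtain ⟨ω, hω⟩ := nonempty_of_measure_ne_zero h
  have hinf : (clusterEdges ω v).Infinite := encard_eq_top_iff.1 hω
  obtain ⟨e, he, u, -, hue⟩ := hinf.nonempty
  obtain ⟨φ, rfl⟩ := htrans u x
  exact ⟨φ.mapEdgeSet ⟨e, he⟩, Sym2.mem_map.2 ⟨u, hue, rfl⟩⟩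

end Final

end Percolation

end

theorem corollary3p3 {V : Type*} (G : SimpleGraph V) [G.LocallyFinite]
    (hconn : G.Connected) (htrans : Percolation.IsTransitive G)
    (hamen : Percolation.IsAmenable G)
    (p : unitInterval) (hpc : Percolation.criticalProb G ≤ p) (hp1 : p < 1) (v : V) :
    Percolation.zeta G p v = 0 := by
  have : Countable V := Percolation.countable_of_connected hconn
  by_contra hζ
  obtain ⟨A, s, hA, hs0, hs1, h⟩ := Percolation.exists_tailBound_of_zeta_ne_zero hζ
  by_cases h0 : Percolation.percMeasure G p (Percolation.sizeTop G v) = 0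
  · have hp : p = Percolation.criticalProb G := le_antisymm
      (le_of_not_gt fun hlt ↦
        Percolation.percMeasure_sizeTop_ne_zero_of_lt htrans hlt v h0) hpc
    subst hp
    exact Percolation.not_tailBound_criticalProb htrans hp1 hA hs0 hs1 h0 h
  · exact Percolation.not_tailBound_of_percolates htrans hamen
      (Percolation.exists_edge_of_percolates htrans h0) hp1 hA hs0 hs1 h0 h
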